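/- All graphs are finite, simple and undirected. A graph is planar if it can be drawn in the plane, with vertices as distinct points and edges as simple arcs joining their ends, in such a way that edges meet only at points corresponding to their common ends; a planar graph is maximal planar if no edge can be added between two distinct nonadjacent vertices without violating planarity. For a graph $G$ let $d_G(u)$ be the degree of the vertex $u$, let $\Delta(G)$ be the largest vertex degree, and let $q(G)$ be the largest eigenvalue of the signless Laplacian matrix $Q(G)=D(G)+A(G)$, where $D(G)$ is the diagonal matrix of vertex degrees and $A(G)$ is the adjacency matrix. Let $G$ be a maximal planar graph of order $n\ge 6$. Then $$q(G)\le \max_{u\in V(G)}\Big\{d_G(u)+2+\frac{3n-9}{d_G(u)}\Big\}.$$ Moreover, (i) if $\Delta(G)=n-1$, then $q(G)\le n+4-\frac{6}{n-1}$; (ii) if $\Delta(G)=n-2$, then $q(G)\le n+3-\frac{3}{n-2}$; (iii) if $\Delta(G)\le n-3$, then $q(G)\le n+2$. -/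

import Mathlib

namespace SimpleGraph

/-- The Euclidean plane. -/
abbrev Plane : Type := EuclideanSpace ℝ (Fin 2)

/-- `s` is a simple (Jordan) arc in the plane with endpoints `p` and `q`: the image of an injective
continuous map from the unit interval which starts at `p` and ends at `q`. -/
def IsSimpleArc (s : Set Plane) (p q : Plane) : Prop :=
  ∃ γ : _root_.Path p q, Function.Injective γ ∧ Set.range γ = s

/-- A planar embedding of `G`: distinct vertices are distinct points of the plane, every edge is a
simple arc joining its two ends, an edge passes through no vertex other than its own ends, and two
different edges meet only at points corresponding to their common ends. -/
structure PlanarEmbedding {V : Type*} (G : SimpleGraph V) where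
  point : V → Plane
  arc : G.edgeSet → Set Plane
  point_injective : Function.Injective point
  isSimpleArc_arc : ∀ (u v : V) (h : G.Adj u v),
    IsSimpleArc (arc ⟨s(u, v), G.mem_edgeSet.mpr h⟩) (point u) (point v)
  mem_of_point_mem_arc : ∀ (e : G.edgeSet) (w : V), point w ∈ arc e → w ∈ (e : Sym2 V)
  arc_inter_arc_subset : ∀ e f : G.edgeSet, e ≠ f →
    arc e ∩ arc f ⊆ point '' {w : V | w ∈ (e : Sym2 V) ∧ w ∈ (f : Sym2 V)}

/-- A graph is planar if it has a planar embedding. -/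
def IsPlanar {V : Type*} (G : SimpleGraph V) : Prop :=
  Nonempty (PlanarEmbedding G)

/-- A planar graph is (edge) maximal if no edge can be added to it (between two distinct
nonadjacent vertices) without violating planarity. -/
def IsMaximalPlanar {V : Type*} (G : SimpleGraph V) : Prop :=
  G.IsPlanar ∧ ∀ u v : V, u ≠ v → ¬ G.Adj u v → ¬ (G ⊔ SimpleGraph.edge u v).IsPlanar

section SignlessLaplacian

variable {V : Type*} [Fintype V] [DecidableEq V] (G : SimpleGraph V) [DecidableRel G.Adj]

/-- The signless Laplacian matrix `Q(G) = D(G) + A(G)` over the reals. -/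
def signlessLapMatrix : Matrix V V ℝ :=
  G.degMatrix ℝ + G.adjMatrix ℝ

/-- The signless Laplacian spectral radius `q(G)`: the largest eigenvalue of `Q(G)`. -/
noncomputable def signlessLapRadius : ℝ :=
  sSup {μ : ℝ | Module.End.HasEigenvalue (Matrix.toLin' G.signlessLapMatrix) μ}

/-- On a nonempty vertex set the supremum in the definition of `q(G)` is attained, so that `q(G)`
is indeed the largest eigenvalue of `Q(G)`. -/
theorem isGreatest_signlessLapRadius [Nonempty V] :
    IsGreatest {μ : ℝ | Module.End.HasEigenvalue (Matrix.toLin' G.signlessLapMatrix) μ}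
      G.signlessLapRadius := by
  have hfin : {μ : ℝ | Module.End.HasEigenvalue (Matrix.toLin' G.signlessLapMatrix) μ}.Finite :=
    Module.End.finite_hasEigenvalue _
  have hherm : G.signlessLapMatrix.IsHermitian :=
    (G.isHermitian_degMatrix ℝ).add (G.isHermitian_adjMatrix ℝ)
  have hne : {μ : ℝ | Module.End.HasEigenvalue
      (Matrix.toLin' G.signlessLapMatrix) μ}.Nonempty := by
    obtain ⟨i⟩ := ‹Nonempty V›
    refine ⟨hherm.eigenvalues i, ?_⟩
    rw [Set.mem_ofPred_eq, Module.End.hasEigenvalue_iff_mem_spectrum, Matrix.spectrum_toLin']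
    exact hherm.eigenvalues_mem_spectrum_real i
  exact ⟨hne.csSup_mem hfin, fun μ hμ => le_csSup hfin.bddAbove hμ⟩

end SignlessLaplacian

end SimpleGraph

/-! Dividing an eigenvector by the degrees bounds a positive q by d(u) + m(u) for some nonisolated
u, where m(u) is the mean degree of the neighbours of u (`exists_eigenvalue_mul_degree_le`). The
neighbour degrees sum to at most e(G) + e(N(u)), and Euler's bound, applied to G and to the closed
neighbourhood of u, gives (3n - 6) + (2d(u) - 3); this is the first inequality. For the rest, f(d) =
d + 2 + (3n - 9)/d is convex with f(3) = f(n - 3) = n + 2, so f(d) ≤ f(D) whenever 3 ≤ d ≤ D and D ≥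
n - 3; for d(u) ≤ 2 the bound m(u) ≤ Δ suffices.

Euler's bound is obtained without faces. Weak planarity, which only asks that independent edges be
disjoint, survives edge contraction and excludes K₅. In a graph with too many edges some vertex has
degree at most 5; if it is not isolated, excluding K₅ yields an edge there in at most two triangles,
whose contraction costs at most three edges, and induction applies. K₅ itself is excluded by a
parity count of winding numbers (the van Kampen obstruction). -/

/-! ### Continuous logarithms and the nonplanarity of K₅. -/

open Complex in
/-- Two continuous logarithms of the same function along the line have the same increments. -/
theorem Complex.sub_eq_sub_of_exp_comp_eq {f g : ℝ → ℂ} (hf : Continuous f) (hg : Continuous g)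
    (h : ∀ t, exp (f t) = exp (g t)) (a b : ℝ) : f b - f a = g b - g a := by
  have key : f = fun t => g t + (f a - g a) := by
    refine Complex.isCoveringMap_exp.eq_of_comp_eq hf (by fun_prop) ?_ a (by ring)
    funext t
    apply Subtype.ext
    change exp (f t) = exp (g t + (f a - g a))
    simp [Complex.exp_add, Complex.exp_sub, h]
  have hb := congrFun key b
  linear_combination hb

/-- A nowhere vanishing continuous function on a contractible, locally path connected space has a
continuous logarithm. -/
theorem Complex.exists_continuous_exp_eq {X : Type*} [TopologicalSpace X]
    [LocallyPathConnectedSpace X] [ContractibleSpace X] {F : X → ℂ} (hF : Continuous F)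
    (h0 : ∀ x, F x ≠ 0) : ∃ L : X → ℂ, Continuous L ∧ ∀ x, exp (L x) = F x := by
  have := (Homeomorph.Set.univ X).contractibleSpace
  have huniv : IsSimplyConnected (Set.univ : Set X) := by
    unfold IsSimplyConnected
    infer_instance
  obtain ⟨L, hL, hexp⟩ := Complex.exists_continuousOn_eqOn_exp_comp (U := (Set.univ : Set X))
    (g := F) huniv isOpen_univ hF.continuousOn
    (by simpa using h0)
  exact ⟨L, continuousOn_univ.mp hL, fun x => hexp (Set.mem_univ x)⟩

/-- The complete graph on five vertices cannot be drawn in the plane by continuous curves such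
that independent edges are disjoint. -/
theorem not_exists_drawing_completeGraph_five (p : Fin 5 → ℂ) (g : Fin 5 → Fin 5 → ℝ → ℂ)
    (hg : ∀ i j, i < j → Continuous (g i j)) (h0 : ∀ i j, i < j → g i j 0 = p i)
    (h1 : ∀ i j, i < j → g i j 1 = p j)
    (hdisj : ∀ i j k l, i < j → k < l → i ≠ k → i ≠ l → j ≠ k → j ≠ l →
      ∀ s t, g i j s ≠ g k l t) : False := by
  have hlt : ∀ i j : Fin 5, i < j → ∃ k l, k < l ∧ i ≠ k ∧ i ≠ l ∧ j ≠ k ∧ j ≠ l := by decide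
  have hthird : ∀ i j k : Fin 5, i < j → k ≠ i → k ≠ j →
      ∃ l, l ≠ k ∧ l ≠ i ∧ l ≠ j := by decide
  have hp : ∀ i j k, i < j → k ≠ i → k ≠ j → ∀ t, g i j t ≠ p k := by
    intro i j k hij hki hkj t
    obtain ⟨l, hlk, hli, hlj⟩ := hthird i j k hij hki hkj
    rcases lt_or_gt_of_ne hlk with h | h
    · rw [← h1 l k h]; exact hdisj i j l k hij h hli.symm hki.symm hlj.symm hkj.symm t 1
    · rw [← h0 k l h]; exact hdisj i j k l hij h hki.symm hli.symm hkj.symm hlj.symm t 0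
  have hne : ∀ i k, i < k → p k - p i ≠ 0 := by
    intro i k hik
    obtain ⟨j, l, hjl, h1', h2, h3, h4⟩ := hlt i k hik
    rw [sub_ne_zero]
    rcases lt_or_gt_of_ne h1' with h | h
    · rw [← h0 i j h]; exact (hp i j k h hik.ne' h3 0).symm
    · rw [← h1 j i h]; exact (hp j i k h h3 hik.ne' 1).symm
  -- Reference logarithms of p b - p a, chosen so that reversing a direction changes them by exactly
  -- ±πi.
  let θ : Fin 5 → Fin 5 → ℂ := fun a b =>
    if a < b then Complex.log (p b - p a) else Complex.log (p a - p b) + Real.pi * Complex.I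
  let s : Fin 5 → Fin 5 → ℤ := fun a b => if a < b then 1 else -1
  have hθexp : ∀ a b, a ≠ b → Complex.exp (θ a b) = p b - p a := by
    intro a b hab
    rcases lt_or_gt_of_ne hab with h | h
    · simp [θ, h, Complex.exp_log (hne a b h)]
    · simp [θ, h.not_gt, Complex.exp_add, Complex.exp_log (hne b a h)]
  have hθs : ∀ a b, a ≠ b → θ b a - θ a b = s a b * (Real.pi * Complex.I) := by
    intro a b hab
    rcases lt_or_gt_of_ne hab with h | h
    · simp [θ, s, h, h.not_gt]
    · simp [θ, s, h, h.not_gt]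
  -- N counts the turns of edge ij seen from p k, relative to θ. The hypotheses sit inside the
  -- existential so that `choose` gives a total function.
  have hN : ∀ k i j, ∃ N : ℤ, i < j → k ≠ i → k ≠ j → ∀ f : ℝ → ℂ, Continuous f →
      (∀ t, Complex.exp (f t) = g i j t - p k) →
      f 1 - f 0 = θ k j - θ k i + N * (2 * Real.pi * Complex.I) := by
    intro k i j
    by_cases hyp : i < j ∧ k ≠ i ∧ k ≠ j
    · obtain ⟨hij, hki, hkj⟩ := hyp
      obtain ⟨L, hL, hLexp⟩ := Complex.exists_continuous_exp_eq
        (F := fun t => g i j t - p k) ((hg i j hij).sub continuous_const)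
        (fun t => sub_ne_zero.mpr (hp i j k hij hki hkj t))
      have : Complex.exp (L 1 - L 0) = Complex.exp (θ k j - θ k i) := by
        rw [Complex.exp_sub, Complex.exp_sub, hLexp, hLexp, hθexp k j hkj, hθexp k i hki,
          h0 i j hij, h1 i j hij]
      obtain ⟨N, hN⟩ := Complex.exp_eq_exp_iff_exists_int.mp this
      refine ⟨N, fun _ _ _ f hf hfexp => ?_⟩
      rw [← hN]
      exact Complex.sub_eq_sub_of_exp_comp_eq hf hL (fun t => by rw [hfexp, hLexp]) 0 1
    · exact ⟨0, fun a b c => absurd ⟨a, b, c⟩ hyp⟩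
  choose N hN using hN
  -- The difference of two disjoint curves has a logarithm on the whole parameter plane, so its
  -- increments around the unit square cancel. Along each side one curve rests at an endpoint, and
  -- `hN` evaluates the increment.
  have key : ∀ i j k l, i < j → k < l → i ≠ k → i ≠ l → j ≠ k → j ≠ l →
      2 * (N k i j + N j k l - N l i j - N i k l) = -(s j k - s i k - s j l + s i l) := by
    intro i j k l hij hkl hik hil hjk hjl
    obtain ⟨L, hL, hLexp⟩ := Complex.exists_continuous_exp_eq
      (F := fun x : ℝ × ℝ => g i j x.1 - g k l x.2)
      (((hg i j hij).comp continuous_fst).sub ((hg k l hkl).comp continuous_snd))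
      (fun x => sub_ne_zero.mpr (hdisj i j k l hij hkl hik hil hjk hjl x.1 x.2))
    have e1 := hN k i j hij hik.symm hjk.symm (fun t => L (t, 0)) (by fun_prop)
      (fun t => by rw [hLexp, h0 k l hkl])
    have e2 := hN l i j hij hil.symm hjl.symm (fun t => L (t, 1)) (by fun_prop)
      (fun t => by rw [hLexp, h1 k l hkl])
    -- The shift by πi turns p i - g k l into g k l - p i.
    have e3 := hN i k l hkl hik hil (fun t => L (0, t) - Real.pi * Complex.I) (by fun_prop)
      (fun t => by rw [Complex.exp_sub, hLexp, h0 i j hij]; simp [div_neg])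
    have e4 := hN j k l hkl hjk hjl (fun t => L (1, t) - Real.pi * Complex.I) (by fun_prop)
      (fun t => by rw [Complex.exp_sub, hLexp, h1 i j hij]; simp [div_neg])
    have s1 := hθs j k hjk
    have s2 := hθs i k hik
    have s3 := hθs j l hjl
    have s4 := hθs i l hil
    have hπ : (Real.pi * Complex.I : ℂ) ≠ 0 := by simp [Real.pi_ne_zero]
    have : ((2 * (N k i j + N j k l - N l i j - N i k l) : ℤ) : ℂ)
        = ((-(s j k - s i k - s j l + s i l) : ℤ) : ℂ) := by
      apply mul_right_cancel₀ hπ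
      push_cast
      linear_combination (-1) * e1 + e2 + e3 - e4 - s1 + s2 + s3 - s4
    exact_mod_cast this
  have a1 := key 0 1 2 3 (by decide) (by decide) (by decide) (by decide) (by decide) (by decide)
  have a2 := key 0 1 2 4 (by decide) (by decide) (by decide) (by decide) (by decide) (by decide)
  have a3 := key 0 1 3 4 (by decide) (by decide) (by decide) (by decide) (by decide) (by decide)
  have a4 := key 0 2 1 3 (by decide) (by decide) (by decide) (by decide) (by decide) (by decide)
  have a5 := key 0 2 1 4 (by decide) (by decide) (by decide) (by decide) (by decide) (by decide)
  have a6 := key 0 2 3 4 (by decide) (by decide) (by decide) (by decide) (by decide) (by decide)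
  have a7 := key 0 3 1 2 (by decide) (by decide) (by decide) (by decide) (by decide) (by decide)
  have a8 := key 0 3 1 4 (by decide) (by decide) (by decide) (by decide) (by decide) (by decide)
  have a9 := key 0 3 2 4 (by decide) (by decide) (by decide) (by decide) (by decide) (by decide)
  have b1 := key 0 4 1 2 (by decide) (by decide) (by decide) (by decide) (by decide) (by decide)
  have b2 := key 0 4 1 3 (by decide) (by decide) (by decide) (by decide) (by decide) (by decide)
  have b3 := key 0 4 2 3 (by decide) (by decide) (by decide) (by decide) (by decide) (by decide)
  have b4 := key 1 2 3 4 (by decide) (by decide) (by decide) (by decide) (by decide) (by decide)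
  have b5 := key 1 3 2 4 (by decide) (by decide) (by decide) (by decide) (by decide) (by decide)
  have b6 := key 1 4 2 3 (by decide) (by decide) (by decide) (by decide) (by decide) (by decide)
  have hs1 : ∀ a b, a < b → s a b = 1 := fun a b h => if_pos h
  have hs2 : ∀ a b, b < a → s a b = -1 := fun a b h => if_neg h.not_gt
  clear_value s θ
  simp only [hs1 _ _ (show (0 : Fin 5) < 1 by decide), hs1 _ _ (show (0 : Fin 5) < 2 by decide),
    hs1 _ _ (show (0 : Fin 5) < 3 by decide), hs1 _ _ (show (0 : Fin 5) < 4 by decide),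
    hs1 _ _ (show (1 : Fin 5) < 2 by decide), hs1 _ _ (show (1 : Fin 5) < 3 by decide),
    hs1 _ _ (show (1 : Fin 5) < 4 by decide), hs1 _ _ (show (2 : Fin 5) < 3 by decide),
    hs1 _ _ (show (2 : Fin 5) < 4 by decide), hs1 _ _ (show (3 : Fin 5) < 4 by decide),
    hs2 _ _ (show (1 : Fin 5) < 2 by decide), hs2 _ _ (show (1 : Fin 5) < 3 by decide),
    hs2 _ _ (show (1 : Fin 5) < 4 by decide), hs2 _ _ (show (2 : Fin 5) < 3 by decide),
    hs2 _ _ (show (2 : Fin 5) < 4 by decide), hs2 _ _ (show (3 : Fin 5) < 4 by decide)] at *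
  -- Halve the fifteen equations and add them modulo 2: each N occurs in exactly two, while the
  -- right side is odd exactly for the five pairs with interleaved ends.
  omega

/-! ### Weak planarity and edge contraction. -/

namespace SimpleGraph

variable {V : Type*}

/-- A graph is weakly planar if it has a drawing in the complex plane in which any two edges
without a common end are disjoint. -/
def IsWeaklyPlanar (G : SimpleGraph V) : Prop :=
  ∃ (p : V → ℂ) (A : V → V → Set ℂ), (∀ u v, G.Adj u v → JoinedIn (A u v) (p u) (p v)) ∧
    ∀ u v x y, G.Adj u v → G.Adj x y → u ≠ x → u ≠ y → v ≠ x → v ≠ y →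
      Disjoint (A u v) (A x y)

theorem IsWeaklyPlanar.mono {G H : SimpleGraph V} (hG : G.IsWeaklyPlanar) (h : H ≤ G) :
    H.IsWeaklyPlanar := by
  obtain ⟨p, A, hA, hd⟩ := hG
  exact ⟨p, A, fun u v huv => hA u v (h huv),
    fun u v x y huv hxy => hd u v x y (h huv) (h hxy)⟩

theorem IsPlanar.isWeaklyPlanar {G : SimpleGraph V} (hG : G.IsPlanar) : G.IsWeaklyPlanar := by
  classical
  obtain ⟨E⟩ := hG
  let φ : Plane → ℂ := fun z => (z 0 : ℂ) + (z 1 : ℂ) * Complex.I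
  have hφ : Continuous φ := by fun_prop
  have hinj : Function.Injective φ := by
    intro z w h
    have hre := congrArg Complex.re h
    have him := congrArg Complex.im h
    simp [φ] at hre him
    ext i
    fin_cases i
    · exact hre
    · exact him
  refine ⟨fun v => φ (E.point v), fun u v => if h : G.Adj u v then
    φ '' E.arc ⟨s(u, v), G.mem_edgeSet.mpr h⟩ else ∅, ?_, ?_⟩
  · intro u v h
    simp only [h, dif_pos]
    obtain ⟨γ, -, hγ⟩ := E.isSimpleArc_arc u v h
    rw [← hγ]
    exact JoinedIn.map ⟨γ, fun t => Set.mem_range_self t⟩ hφ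
  · intro u v x y h h' hux huy hvx hvy
    simp only [h, h', dif_pos]
    rw [Set.disjoint_image_iff hinj, Set.disjoint_iff]
    have hne : (⟨s(u, v), G.mem_edgeSet.mpr h⟩ : G.edgeSet) ≠ ⟨s(x, y), G.mem_edgeSet.mpr h'⟩ := by
      simp [hux, huy]
    intro z hz
    obtain ⟨w, ⟨hw1, hw2⟩, -⟩ := E.arc_inter_arc_subset _ _ hne hz
    simp only [Sym2.mem_iff] at hw1 hw2
    rcases hw1 with rfl | rfl <;> rcases hw2 with h | h <;> contradiction

/-- A weakly planar graph contains no complete graph on five vertices. -/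
theorem IsWeaklyPlanar.not_pairwise_adj {G : SimpleGraph V} (hG : G.IsWeaklyPlanar)
    (f : Fin 5 → V) (hf : ∀ i j, i ≠ j → G.Adj (f i) (f j)) : False := by
  obtain ⟨p, A, hA, hd⟩ := hG
  have hne : ∀ i j, i ≠ j → f i ≠ f j := fun i j h => (hf i j h).ne
  let γ : ∀ i j, i < j → _root_.Path (p (f i)) (p (f j)) := fun i j h => (hA _ _ (hf i j h.ne)).somePath
  refine not_exists_drawing_completeGraph_five (fun i => p (f i))
    -- `extend` is constant outside the unit interval, so disjointness persists for all real
    -- parameters.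
    (fun i j t => if h : i < j then (γ i j h).extend t else 0) ?_ ?_ ?_ ?_
  · intro i j h; simp only [h, dif_pos]; exact (γ i j h).continuous_extend
  · intro i j h; simp [h]
  · intro i j h; simp [h]
  · intro i j k l h h' h1 h2 h3 h4 s t
    simp only [h, h', dif_pos]
    refine (hd _ _ _ _ (hf i j h.ne) (hf k l h'.ne) (hne _ _ h1) (hne _ _ h2) (hne _ _ h3)
      (hne _ _ h4)).ne_of_mem ?_ ?_ <;> exact JoinedIn.somePath_mem _ _

/-- Contracting the edge `xy` (to the vertex `x`) preserves weak planarity. -/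
theorem IsWeaklyPlanar.contract {G H : SimpleGraph V} (hG : G.IsWeaklyPlanar) {x y : V}
    (hxy : G.Adj x y) (hy : ∀ a, ¬ H.Adj a y)
    (hH : ∀ a b, H.Adj a b → G.Adj a b ∨ (a = x ∧ G.Adj y b) ∨ (b = x ∧ G.Adj a y)) :
    H.IsWeaklyPlanar := by
  classical
  obtain ⟨p, A, hA, hd⟩ := hG
  refine ⟨p, fun a b => if G.Adj a b then A a b else if a = x then A x y ∪ A y b
    else A a y ∪ A x y, ?_, ?_⟩
  · intro a b hab
    by_cases h : G.Adj a b
    · simp only [h, if_true]; exact hA a b h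
    · rcases hH a b hab with h' | ⟨rfl, h'⟩ | ⟨rfl, h'⟩
      · exact absurd h' h
      · simp only [h, if_false, if_true]
        exact ((hA _ _ hxy).mono Set.subset_union_left).trans
          ((hA _ _ h').mono Set.subset_union_right)
      · simp only [h, if_false, hab.ne]
        exact ((hA _ _ h').mono Set.subset_union_left).trans
          ((hA _ _ hxy).mono Set.subset_union_right).symm
  · intro a b c d hab hcd hac had hbc hbd
    have hay : a ≠ y := fun h => hy b (h ▸ hab.symm)
    have hby : b ≠ y := fun h => hy a (h ▸ hab)
    have hcy : c ≠ y := fun h => hy d (h ▸ hcd.symm)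
    have hdy : d ≠ y := fun h => hy c (h ▸ hcd)
    have h1 := hH a b hab
    have h2 := hH c d hcd
    have hxy' := hxy.ne
    have := hab.ne
    have := hcd.ne
    by_cases h : G.Adj a b <;> by_cases h' : G.Adj c d <;> simp only [h, h', if_true, if_false]
    · exact hd _ _ _ _ h h' hac had hbc hbd
    · rcases h2 with h2 | ⟨rfl, h2⟩ | ⟨rfl, h2⟩
      · exact absurd h2 h'
      · rw [if_pos rfl, Set.disjoint_union_right]
        constructor <;> apply hd <;> assumption
      · rw [if_neg hcd.ne, Set.disjoint_union_right]
        constructor <;> apply hd <;> assumption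
    · rcases h1 with h1 | ⟨rfl, h1⟩ | ⟨rfl, h1⟩
      · exact absurd h1 h
      · rw [if_pos rfl, Set.disjoint_union_left]
        constructor <;> apply hd <;> first | assumption | (apply Ne.symm; assumption)
      · rw [if_neg hab.ne, Set.disjoint_union_left]
        constructor <;> apply hd <;> first | assumption | (apply Ne.symm; assumption)
    -- Two rerouted edges both end at x, so they are not independent.
    · exfalso
      rcases h1 with h1 | ⟨rfl, h1⟩ | ⟨rfl, h1⟩ <;> rcases h2 with h2 | ⟨rfl, h2⟩ | ⟨rfl, h2⟩ <;>
        contradiction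

end SimpleGraph

namespace SimpleGraph

variable {V : Type*}

theorem IsWeaklyPlanar.not_isClique {G : SimpleGraph V} (hG : G.IsWeaklyPlanar) {s : Finset V}
    (hs : G.IsClique (s : Set V)) (h5 : 5 ≤ s.card) : False := by
  obtain ⟨t, hts, ht⟩ := Finset.exists_subset_card_eq h5
  let e := (t.equivFinOfCardEq ht).symm
  refine hG.not_pairwise_adj (fun i => (e i : V)) fun i j hij => ?_
  refine hs (hts (e i).2) (hts (e j).2) fun h => hij (e.injective (Subtype.ext h))

/-- The graph obtained by contracting `y` into `x`, with `y` kept as an isolated vertex. -/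
def contractEdge (G : SimpleGraph V) (x y : V) : SimpleGraph V where
  Adj a b := a ≠ b ∧ a ≠ y ∧ b ≠ y ∧ (G.Adj a b ∨ (a = x ∧ G.Adj y b) ∨ (b = x ∧ G.Adj a y))
  symm := ⟨fun a b h => by
    obtain ⟨h1, h2, h3, h4⟩ := h
    refine ⟨h1.symm, h3, h2, ?_⟩
    rcases h4 with h | ⟨h, h'⟩ | ⟨h, h'⟩
    · exact Or.inl h.symm
    · exact Or.inr (Or.inr ⟨h, h'.symm⟩)
    · exact Or.inr (Or.inl ⟨h, h'.symm⟩)⟩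
  loopless := ⟨fun a h => h.1 rfl⟩

theorem IsWeaklyPlanar.contractEdge {G : SimpleGraph V} (hG : G.IsWeaklyPlanar) {x y : V}
    (hxy : G.Adj x y) : (G.contractEdge x y).IsWeaklyPlanar :=
  hG.contract hxy (fun _ h => h.2.2.1 rfl) fun _ _ h => h.2.2.2

/-- The join of an edge `vw` and a four-cycle `abcd`, that is, an octahedron with one more edge, is
not weakly planar. -/
theorem IsWeaklyPlanar.not_octahedron_add_edge {G : SimpleGraph V} (hG : G.IsWeaklyPlanar)
    {v w a b c d : V} (hva : G.Adj v a) (hvb : G.Adj v b) (hvc : G.Adj v c) (hvd : G.Adj v d)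
    (hvw : G.Adj v w) (hwa : G.Adj w a) (hwb : G.Adj w b) (hwc : G.Adj w c) (hwd : G.Adj w d)
    (hab : G.Adj a b) (hbc : G.Adj b c) (hda : G.Adj d a) (hdc : G.Adj d c) (hac : a ≠ c)
    (hbd : b ≠ d) : False := by
  have lift : ∀ {s t : V}, G.Adj s t → s ≠ b → t ≠ b → (G.contractEdge a b).Adj s t :=
    fun h hs ht => ⟨h.ne, hs, ht, Or.inl h⟩
  have e1 := lift hva hvb.ne hab.ne
  have e2 := lift hvc hvb.ne hbc.ne'
  have e3 := lift hvd hvb.ne hbd.symm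
  have e4 := lift hvw hvb.ne hwb.ne
  have e5 := lift hwa hwb.ne hab.ne
  have e6 := lift hwc hwb.ne hbc.ne'
  have e7 := lift hwd hwb.ne hbd.symm
  have e8 := lift hda hbd.symm hab.ne
  have e9 := lift hdc hbd.symm hbc.ne'
  have e0 : (G.contractEdge a b).Adj a c := ⟨hac, hab.ne, hbc.ne', Or.inr (Or.inl ⟨rfl, hbc⟩)⟩
  refine (hG.contractEdge hab).not_pairwise_adj ![v, w, a, c, d] fun i j hij => ?_
  fin_cases i <;> fin_cases j <;>
    first
    | exact absurd rfl hij
    | assumption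
    | (apply SimpleGraph.Adj.symm; assumption)

/-! ### Euler's bound by contraction. -/

section Counting

variable [Fintype V] [DecidableEq V]

/-- Only xy and one edge per common neighbour are lost: edges avoiding y survive, and each z ≠ x
adjacent to y but not to x contributes a new edge xz. -/
theorem card_edgeFinset_le_contractEdge (G : SimpleGraph V) [DecidableRel G.Adj] {x y : V}
    [DecidableRel (G.contractEdge x y).Adj] (hxy : G.Adj x y) :
    G.edgeFinset.card ≤ (G.contractEdge x y).edgeFinset.card + 1 +
      (G.neighborFinset x ∩ G.neighborFinset y).card := by
  set R := (G.neighborFinset y \ G.neighborFinset x).erase x with hR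
  have hdeg : G.degree y = R.card + 1 + (G.neighborFinset x ∩ G.neighborFinset y).card := by
    have hx : x ∈ G.neighborFinset y \ G.neighborFinset x := by simp [hxy.symm]
    rw [hR, Finset.card_erase_add_one hx, Finset.inter_comm, Finset.card_sdiff_add_card_inter,
      card_neighborFinset_eq_degree]
  have hsplit : G.edgeFinset.card = (G.edgeFinset \ G.incidenceFinset y).card + G.degree y := by
    rw [← G.card_incidenceFinset_eq_degree, Finset.card_sdiff_add_card_eq_card
      (G.incidenceFinset_subset y)]
  have himg : (R.image fun z => s(x, z)).card = R.card :=
    Finset.card_image_of_injective _ fun _ _ h => Sym2.congr_right.mp h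
  have hdisj : Disjoint (G.edgeFinset \ G.incidenceFinset y) (R.image fun z => s(x, z)) := by
    rw [Finset.disjoint_right]
    intro e he he'
    obtain ⟨z, hz, rfl⟩ := Finset.mem_image.mp he
    simp [hR] at hz
    simp [hz.2.2] at he'
  have hsub : (G.edgeFinset \ G.incidenceFinset y) ∪ (R.image fun z => s(x, z)) ⊆
      (G.contractEdge x y).edgeFinset := by
    intro e he
    rw [Finset.mem_union] at he
    rcases he with he | he
    · induction e with
      | _ a b =>
        simp only [Finset.mem_sdiff, mem_edgeFinset, mem_edgeSet, mem_incidenceFinset,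
          mk'_mem_incidenceSet_iff, not_and, not_or] at he
        rw [mem_edgeFinset, mem_edgeSet]
        have := he.2 he.1
        exact ⟨he.1.ne, fun h => this.1 h.symm, fun h => this.2 h.symm, Or.inl he.1⟩
    · obtain ⟨z, hz, rfl⟩ := Finset.mem_image.mp he
      simp only [hR, Finset.mem_erase, Finset.mem_sdiff, mem_neighborFinset] at hz
      rw [mem_edgeFinset, mem_edgeSet]
      exact ⟨hz.1.symm, hxy.ne, hz.2.1.ne', Or.inr (Or.inl ⟨rfl, hz.2.1⟩)⟩
  have := Finset.card_le_card hsub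
  rw [Finset.card_union_of_disjoint hdisj, himg] at this
  omega

/-- In a weakly planar graph, every vertex of degree between one and five lies on an edge that is
contained in at most two triangles. -/
theorem IsWeaklyPlanar.card_inter_neighborFinset_le {G : SimpleGraph V} [DecidableRel G.Adj]
    (hG : G.IsWeaklyPlanar) {v : V} (h0 : 0 < G.degree v) (h5 : G.degree v ≤ 5) :
    ∃ w ∈ G.neighborFinset v, (G.neighborFinset v ∩ G.neighborFinset w).card ≤ 2 := by
  by_contra! hcon
  have hnon : ∀ w ∈ G.neighborFinset v,
      ((G.neighborFinset v).erase w \ G.neighborFinset w).card + 4 ≤ G.degree v := by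
    intro w hw
    have h := hcon w hw
    have h1 : G.neighborFinset v ∩ G.neighborFinset w =
        (G.neighborFinset v).erase w ∩ G.neighborFinset w := by
      ext z
      simp only [Finset.mem_inter, Finset.mem_erase, mem_neighborFinset]
      exact ⟨fun h => ⟨⟨h.2.ne', h.1⟩, h.2⟩, fun h => ⟨h.1.2, h.2⟩⟩
    have h2 := Finset.card_sdiff_add_card_inter ((G.neighborFinset v).erase w)
      (G.neighborFinset w)
    have h3 := Finset.card_erase_add_one hw
    rw [card_neighborFinset_eq_degree] at h3
    rw [h1] at h
    omega
  -- Since deg v ≤ 5, `hnon` lets a neighbour of v miss at most one other neighbour.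
  have hadj : ∀ w z z', G.Adj v w → G.Adj v z → G.Adj v z' → w ≠ z → w ≠ z' → z ≠ z' →
      ¬ G.Adj w z → G.Adj w z' := by
    intro w z z' hw hz hz' hwz hwz' hzz' hn
    by_contra hn'
    have hsub : {z, z'} ⊆ (G.neighborFinset v).erase w \ G.neighborFinset w := by
      intro t ht
      rw [Finset.mem_insert, Finset.mem_singleton] at ht
      rcases ht with rfl | rfl
      · simp [*, hwz.symm]
      · simp [*, hwz'.symm]
    have h1 := Finset.card_le_card hsub
    rw [Finset.card_pair hzz'] at h1
    have := hnon w (by simpa using hw)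
    omega
  obtain ⟨w₀, hw₀⟩ := Finset.card_pos.mp (by rwa [card_neighborFinset_eq_degree] :
    0 < (G.neighborFinset v).card)
  have hdeg4 := hnon w₀ hw₀
  by_cases hcl : ∀ a c, G.Adj v a → G.Adj v c → a ≠ c → G.Adj a c
  · refine hG.not_isClique (s := insert v (G.neighborFinset v)) ?_ ?_
    · intro a ha c hc hac
      simp only [Finset.coe_insert, Set.mem_insert_iff, Finset.mem_coe, mem_neighborFinset]
        at ha hc
      rcases ha with rfl | ha <;> rcases hc with rfl | hc
      · exact absurd rfl hac
      · exact hc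
      · exact ha.symm
      · exact hcl a c ha hc hac
    · rw [Finset.card_insert_of_notMem (by simp), card_neighborFinset_eq_degree]
      omega
  · push Not at hcl
    obtain ⟨a, c, hva, hvc, hac, hnac⟩ := hcl
    have hdeg : G.degree v = 5 := by
      have := hnon a (by simpa using hva)
      have : 0 < ((G.neighborFinset v).erase a \ G.neighborFinset a).card :=
        Finset.card_pos.mpr ⟨c, by simp [hvc, hnac, hac.symm]⟩
      omega
    have hc3 : (((G.neighborFinset v).erase a).erase c).card = 3 := by
      have h1 := Finset.card_erase_add_one
        (show a ∈ G.neighborFinset v by simpa using hva)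
      have h2 := Finset.card_erase_add_one
        (show c ∈ (G.neighborFinset v).erase a by simp [hvc, hac.symm])
      rw [card_neighborFinset_eq_degree] at h1
      omega
    obtain ⟨p, q, r, hpq, hpr, hqr, hset⟩ := Finset.card_eq_three.mp hc3
    have hmem : ∀ z ∈ ({p, q, r} : Finset V), G.Adj v z ∧ G.Adj z a ∧ G.Adj z c := by
      intro z hz
      rw [← hset] at hz
      simp only [Finset.mem_erase, mem_neighborFinset] at hz
      obtain ⟨hzc, hza, hvz⟩ := hz
      exact ⟨hvz, (hadj a c z hva hvc hvz hac hza.symm hzc.symm hnac).symm,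
        (hadj c a z hvc hva hvz hac.symm hzc.symm hza.symm fun h => hnac h.symm).symm⟩
    obtain ⟨hvp, hpa, hpc⟩ := hmem p (by simp)
    obtain ⟨hvq, hqa, hqc⟩ := hmem q (by simp)
    obtain ⟨hvr, hra, hrc⟩ := hmem r (by simp)
    have main : ∀ w b d, G.Adj v w ∧ G.Adj w a ∧ G.Adj w c → G.Adj v b ∧ G.Adj b a ∧ G.Adj b c →
        G.Adj v d ∧ G.Adj d a ∧ G.Adj d c → G.Adj w b → G.Adj w d → b ≠ d → False :=
      fun w b d hw hb hd hwb hwd hbd => hG.not_octahedron_add_edge hva hb.1 hvc hd.1 hw.1 hw.2.1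
        hwb hw.2.2 hwd hb.2.1.symm hb.2.2 hd.2.1 hd.2.2 hac hbd
    have hp := hmem p (by simp)
    have hq := hmem q (by simp)
    have hr := hmem r (by simp)
    -- Each of p, q, r misses at most one other, so one of them is adjacent to both others. With v
    -- it is joined to the four-cycle through a, c and those two.
    by_cases h1 : G.Adj p q
    · by_cases h2 : G.Adj p r
      · exact main p q r hp hq hr h1 h2 hqr
      · exact main q p r hq hp hr h1.symm
          (hadj r p q hvr hvp hvq hpr.symm hqr.symm hpq fun h => h2 h.symm).symm hpr
    · exact main r p q hr hp hq (hadj p q r hvp hvq hvr hpq hpr hqr h1).symm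
        (hadj q p r hvq hvp hvr hpq.symm hqr hpr fun h => h1 h.symm).symm hpq

/-- A weakly planar graph whose edges lie in a set `S` of at least three vertices has at most
`3 |S| - 6` edges. -/
theorem IsWeaklyPlanar.card_edgeFinset_add_six_le (m : ℕ) :
    ∀ (G : SimpleGraph V) [DecidableRel G.Adj] (S : Finset V), G.IsWeaklyPlanar →
      (∀ a b, G.Adj a b → a ∈ S) → S.card = m + 3 → G.edgeFinset.card + 6 ≤ 3 * S.card := by
  classical
  induction m with
  | zero =>
    intro G _ S _ hS hcard
    have hsub : G.edgeFinset ⊆ S.offDiag.image (Function.uncurry Sym2.mk) := by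
      intro e he
      induction e with
      | _ a b =>
        rw [mem_edgeFinset, mem_edgeSet] at he
        rw [Finset.mem_image]
        exact ⟨(a, b), by simp [hS a b he, hS b a he.symm, he.ne], rfl⟩
    have h1 := Finset.card_le_card hsub
    rw [Sym2.card_image_offDiag, hcard] at h1
    have : Nat.choose (0 + 3) 2 = 3 := rfl
    omega
  | succ m ih =>
    intro G _ S hG hS hcard
    by_contra hlt
    -- Exactly 3|S| - 5 edges are kept, so that the average degree on S is below six.
    obtain ⟨T, hT, hTcard⟩ := Finset.exists_subset_card_eq
      (show 3 * S.card - 5 ≤ G.edgeFinset.card by omega)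
    have hle : fromEdgeSet (T : Set (Sym2 V)) ≤ G := by
      intro a b hab
      rw [fromEdgeSet_adj] at hab
      have := hT (Finset.mem_coe.mp hab.1)
      rwa [mem_edgeFinset, mem_edgeSet] at this
    obtain ⟨K, hK⟩ : ∃ K, K = fromEdgeSet (T : Set (Sym2 V)) := ⟨_, rfl⟩
    rw [← hK] at hle
    have hKE : K.edgeFinset = T := by
      ext e
      induction e with
      | _ a b =>
        rw [mem_edgeFinset, mem_edgeSet, hK, fromEdgeSet_adj]
        refine ⟨fun h => Finset.mem_coe.mp h.1, fun h => ⟨Finset.mem_coe.mpr h, ?_⟩⟩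
        have := hT h
        rw [mem_edgeFinset, mem_edgeSet] at this
        exact this.ne
    rw [← hKE] at hTcard
    replace hS : ∀ a b, K.Adj a b → a ∈ S := fun a b h => hS a b (hle h)
    replace hG := hG.mono hle
    obtain ⟨v, hvS, hv5⟩ : ∃ v ∈ S, K.degree v ≤ 5 := by
      by_contra! h
      have h1 : S.card • 6 ≤ ∑ v ∈ S, K.degree v := Finset.card_nsmul_le_sum _ _ _ h
      have h2 : ∑ v ∈ S, K.degree v ≤ ∑ v, K.degree v :=
        Finset.sum_le_sum_of_subset (Finset.subset_univ S)
      rw [K.sum_degrees_eq_twice_card_edges] at h2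
      rw [smul_eq_mul] at h1
      omega
    have hcard' := Finset.card_erase_add_one hvS
    rcases Nat.eq_zero_or_pos (K.degree v) with h0 | h0
    · have := ih K (S.erase v) hG (fun a b h => Finset.mem_erase.mpr ⟨?_, hS a b h⟩) (by omega)
      · omega
      · rintro rfl
        have := (K.degree_pos_iff_exists_adj a).mpr ⟨b, h⟩
        omega
    · obtain ⟨w, hw, hle2⟩ := hG.card_inter_neighborFinset_le h0 hv5
      rw [mem_neighborFinset] at hw
      have h1 := K.card_edgeFinset_le_contractEdge hw.symm
      rw [Finset.inter_comm] at h1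
      have := ih (K.contractEdge w v) (S.erase v) (hG.contractEdge hw.symm) (fun a b h => ?_)
        (by omega)
      · omega
      · refine Finset.mem_erase.mpr ⟨h.2.1, ?_⟩
        rcases h.2.2.2 with h' | ⟨rfl, -⟩ | ⟨-, h'⟩
        · exact hS _ _ h'
        · exact hS _ _ hw.symm
        · exact hS _ _ h'

end Counting

end SimpleGraph

/-! ### Degree sums over a neighbourhood. -/

namespace SimpleGraph

variable {V : Type*} [Fintype V]

theorem sum_degree_neighborFinset_le_mul_maxDegree (G : SimpleGraph V) [DecidableRel G.Adj]
    (u : V) : ∑ v ∈ G.neighborFinset u, G.degree v ≤ G.degree u * G.maxDegree := by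
  have := Finset.sum_le_card_nsmul (G.neighborFinset u) (fun v => G.degree v) G.maxDegree
    fun v _ => G.degree_le_maxDegree v
  rwa [card_neighborFinset_eq_degree, smul_eq_mul] at this

variable [DecidableEq V]

/-- In a weakly planar graph, at most `2 d - 3` edges join neighbours of a vertex of degree
`d ≥ 2`. -/
theorem IsWeaklyPlanar.card_edges_neighborFinset_le {G : SimpleGraph V} [DecidableRel G.Adj]
    (hG : G.IsWeaklyPlanar) {u : V} (h2 : 2 ≤ G.degree u) :
    (G.edgeFinset.filter fun e => ∀ a ∈ e, a ∈ G.neighborFinset u).card + 3 ≤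
      2 * G.degree u := by
  classical
  obtain ⟨H, hHdef⟩ : ∃ H : SimpleGraph V, ∀ a b, H.Adj a b ↔
      G.Adj a b ∧ a ∈ insert u (G.neighborFinset u) ∧ b ∈ insert u (G.neighborFinset u) :=
    ⟨⟨fun a b => G.Adj a b ∧ a ∈ insert u (G.neighborFinset u) ∧
        b ∈ insert u (G.neighborFinset u), ⟨fun a b h => ⟨h.1.symm, h.2.2, h.2.1⟩⟩,
      ⟨fun a h => h.1.ne rfl⟩⟩, fun _ _ => Iff.rfl⟩
  have hcard : (insert u (G.neighborFinset u)).card = G.degree u + 1 := by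
    rw [Finset.card_insert_of_notMem (by simp), card_neighborFinset_eq_degree]
  have hE := IsWeaklyPlanar.card_edgeFinset_add_six_le (G.degree u - 2) H
    (insert u (G.neighborFinset u)) (hG.mono fun a b h => ((hHdef a b).mp h).1)
    (fun a b h => ((hHdef a b).mp h).2.1) (by omega)
  have hdisj : Disjoint (G.edgeFinset.filter fun e => ∀ a ∈ e, a ∈ G.neighborFinset u)
      (G.incidenceFinset u) := by
    rw [Finset.disjoint_left]
    intro e he he'
    have := (Finset.mem_filter.mp he).2 u ((G.mem_incidenceFinset u e).mp he').2
    simp at this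
  have hsub : (G.edgeFinset.filter fun e => ∀ a ∈ e, a ∈ G.neighborFinset u) ∪
      G.incidenceFinset u ⊆ H.edgeFinset := by
    intro e he
    induction e with
    | _ a b =>
      rw [mem_edgeFinset, mem_edgeSet, hHdef]
      rw [Finset.mem_union, Finset.mem_filter, mem_edgeFinset, mem_edgeSet, mem_incidenceFinset,
        mk'_mem_incidenceSet_iff] at he
      rcases he with ⟨h, hm⟩ | ⟨h, rfl | rfl⟩
      · exact ⟨h, Finset.mem_insert_of_mem (hm a (Sym2.mem_mk_left a b)),
          Finset.mem_insert_of_mem (hm b (Sym2.mem_mk_right a b))⟩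
      · exact ⟨h, by simp, by simp [h]⟩
      · exact ⟨h, by simp [h.symm], by simp⟩
  -- Of the at most 3(d + 1) - 6 edges in the closed neighbourhood, d are incident to u.
  have := Finset.card_le_card hsub
  rw [Finset.card_union_of_disjoint hdisj, card_incidenceFinset_eq_degree] at this
  omega

/-- Double counting: an edge contributes once for each of its ends in N. -/
theorem sum_degree_le_card_edgeFinset_add (G : SimpleGraph V) [DecidableRel G.Adj]
    (N : Finset V) : ∑ v ∈ N, G.degree v ≤
      G.edgeFinset.card + (G.edgeFinset.filter fun e => ∀ a ∈ e, a ∈ N).card := by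
  calc ∑ v ∈ N, G.degree v = ∑ v ∈ N, ∑ e ∈ G.edgeFinset, if v ∈ e then 1 else 0 := by
        refine Finset.sum_congr rfl fun v _ => ?_
        rw [← card_incidenceFinset_eq_degree, incidenceFinset_eq_filter, Finset.card_filter]
    _ = ∑ e ∈ G.edgeFinset, ∑ v ∈ N, if v ∈ e then 1 else 0 := Finset.sum_comm
    _ ≤ ∑ e ∈ G.edgeFinset, (1 + if ∀ a ∈ e, a ∈ N then 1 else 0) := by
        refine Finset.sum_le_sum fun e _ => ?_
        induction e with
        | _ a b =>
          rw [← Finset.card_filter]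
          split_ifs with h
          · refine (Finset.card_le_card (t := {a, b}) fun z hz => ?_).trans Finset.card_le_two
            simpa using (Finset.mem_filter.mp hz).2
          · rw [add_zero, Finset.card_le_one]
            intro z hz z' hz'
            simp only [Finset.mem_filter, Sym2.mem_iff] at hz hz'
            simp only [Sym2.mem_iff, forall_eq_or_imp, forall_eq, not_and_or] at h
            obtain ⟨hz, rfl | rfl⟩ := hz <;> obtain ⟨hz', rfl | rfl⟩ := hz' <;> tauto
    _ = _ := by rw [Finset.sum_add_distrib, Finset.card_filter, Finset.card_eq_sum_ones]

theorem IsWeaklyPlanar.sum_degree_neighborFinset_le {G : SimpleGraph V} [DecidableRel G.Adj]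
    (hG : G.IsWeaklyPlanar) (hV : 3 ≤ Fintype.card V) {u : V} (h0 : 0 < G.degree u) :
    ∑ v ∈ G.neighborFinset u, G.degree v + 9 ≤ 2 * G.degree u + 3 * Fintype.card V := by
  rcases Nat.lt_or_ge 1 (G.degree u) with h | h
  · have h1 := hG.card_edges_neighborFinset_le h
    have h2 := G.sum_degree_le_card_edgeFinset_add (G.neighborFinset u)
    have h3 := IsWeaklyPlanar.card_edgeFinset_add_six_le (Fintype.card V - 3) G Finset.univ hG
      (fun _ _ _ => Finset.mem_univ _) (by rw [Finset.card_univ]; omega)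
    rw [Finset.card_univ] at h3
    omega
  -- For degree one the bound 2d - 3 on e(N(u)) fails, but the only neighbour has degree at most n -
  -- 1.
  · have h1 : ∑ v ∈ G.neighborFinset u, G.degree v ≤ (G.neighborFinset u).card •
        (Fintype.card V - 1) :=
      Finset.sum_le_card_nsmul _ _ _ fun v _ => by have := G.degree_lt_card_verts v; omega
    have h2 : G.degree u = 1 := by omega
    rw [card_neighborFinset_eq_degree, h2, one_smul] at h1
    omega

/-! ### The spectral bound. -/

/-- A positive eigenvalue of the signless Laplacian is at most the sum of the degree and the
average neighbour degree of some nonisolated vertex. -/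
theorem exists_eigenvalue_mul_degree_le (G : SimpleGraph V) [DecidableRel G.Adj] {μ : ℝ}
    (hμ : Module.End.HasEigenvalue (Matrix.toLin' G.signlessLapMatrix) μ) (hpos : 0 < μ) :
    ∃ u, 0 < G.degree u ∧
      μ * G.degree u ≤ (G.degree u : ℝ) ^ 2 + ∑ v ∈ G.neighborFinset u, (G.degree v : ℝ) := by
  obtain ⟨x, hx⟩ := hμ.exists_hasEigenvector
  have hmul : ∀ u, (G.degree u : ℝ) * x u + ∑ v ∈ G.neighborFinset u, x v = μ * x u := by
    intro u
    have := congrFun hx.apply_eq_smul u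
    simpa [signlessLapMatrix, Matrix.add_mulVec, degMatrix, Matrix.mulVec_diagonal] using this
  have hiso : ∀ u, G.degree u = 0 → x u = 0 := by
    intro u hu
    have h := hmul u
    have hN : G.neighborFinset u = ∅ := by
      rw [← Finset.card_eq_zero, card_neighborFinset_eq_degree, hu]
    rw [hN, hu] at h
    simpa [hpos.ne'] using h
  -- The vertex u sought maximises |y|. At isolated vertices the quotient is 0, consistent with
  -- `hiso`.
  let y : V → ℝ := fun u => x u / G.degree u
  have hxy : ∀ u, x u = G.degree u * y u := by
    intro u
    by_cases hu : G.degree u = 0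
    · simp [hu, hiso u hu]
    · have : (G.degree u : ℝ) ≠ 0 := by exact_mod_cast hu
      simp only [y]
      field_simp
  obtain ⟨w, hw⟩ : ∃ w, x w ≠ 0 := by
    by_contra! h
    exact hx.2 (funext h)
  obtain ⟨u, -, hu⟩ := Finset.exists_max_image Finset.univ (fun v => |y v|) ⟨w, Finset.mem_univ w⟩
  have hyw : y w ≠ 0 := fun h => hw (by rw [hxy, h, mul_zero])
  have hyu : 0 < |y u| := (abs_pos.mpr hyw).trans_le (hu w (Finset.mem_univ w))
  have hdu : 0 < G.degree u := by
    rw [Nat.pos_iff_ne_zero]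
    intro h
    simp [y, h] at hyu
  have hd : (0 : ℝ) < G.degree u := by exact_mod_cast hdu
  refine ⟨u, hdu, le_of_mul_le_mul_right ?_ hyu⟩
  have h1 : (μ - G.degree u) * G.degree u * y u =
      ∑ v ∈ G.neighborFinset u, (G.degree v : ℝ) * y v := by
    have h := hmul u
    simp only [hxy] at h
    linear_combination -h
  have h2 : (μ - G.degree u) * G.degree u * |y u| ≤
      (∑ v ∈ G.neighborFinset u, (G.degree v : ℝ)) * |y u| :=
    calc (μ - G.degree u) * G.degree u * |y u|
        ≤ |(μ - G.degree u) * G.degree u * y u| := by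
          rw [abs_mul _ (y u)]
          exact mul_le_mul_of_nonneg_right (le_abs_self _) (abs_nonneg _)
      _ ≤ ∑ v ∈ G.neighborFinset u, |(G.degree v : ℝ) * y v| := by
          rw [h1]; exact Finset.abs_sum_le_sum_abs _ _
      _ ≤ ∑ v ∈ G.neighborFinset u, (G.degree v : ℝ) * |y u| := by
          refine Finset.sum_le_sum fun v _ => ?_
          rw [abs_mul, Nat.abs_cast]
          exact mul_le_mul_of_nonneg_left (hu v (Finset.mem_univ v)) (Nat.cast_nonneg _)
      _ = _ := by rw [Finset.sum_mul]
  linarith [h2]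

end SimpleGraph

/-! ### Assembling the bounds. -/

theorem lemma3p1 {V : Type*} [Fintype V] [DecidableEq V] (G : SimpleGraph V) [DecidableRel G.Adj]
    (n : ℕ) (hcard : Fintype.card V = n) (hn : 6 ≤ n) (hG : G.IsMaximalPlanar) :
    G.signlessLapRadius ≤
        ⨆ u : V, ((G.degree u : ℝ) + 2 + (3 * (n : ℝ) - 9) / (G.degree u : ℝ)) ∧
    (G.maxDegree = n - 1 → G.signlessLapRadius ≤ (n : ℝ) + 4 - 6 / ((n : ℝ) - 1)) ∧
    (G.maxDegree = n - 2 → G.signlessLapRadius ≤ (n : ℝ) + 3 - 3 / ((n : ℝ) - 2)) ∧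
    (G.maxDegree ≤ n - 3 → G.signlessLapRadius ≤ (n : ℝ) + 2) := by
  have : Nonempty V := Fintype.card_pos_iff.mp (by omega)
  have hq := G.isGreatest_signlessLapRadius.1
  have hn' : (6 : ℝ) ≤ n := by exact_mod_cast hn
  have hbdd : BddAbove (Set.range fun u : V =>
      ((G.degree u : ℝ) + 2 + (3 * (n : ℝ) - 9) / (G.degree u : ℝ))) :=
    (Set.finite_range _).bddAbove
  rcases le_or_gt G.signlessLapRadius 0 with h0 | h0
  · have e1 : 6 / ((n : ℝ) - 1) ≤ 6 := by rw [div_le_iff₀ (by linarith)]; linarith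
    have e2 : 3 / ((n : ℝ) - 2) ≤ 3 := by rw [div_le_iff₀ (by linarith)]; linarith
    refine ⟨?_, fun _ => by linarith, fun _ => by linarith, fun _ => by linarith⟩
    obtain ⟨u⟩ := ‹Nonempty V›
    refine (h0.trans ?_).trans (le_ciSup hbdd u)
    have : 0 ≤ (3 * (n : ℝ) - 9) / (G.degree u : ℝ) :=
      div_nonneg (by linarith) (Nat.cast_nonneg _)
    positivity
  · obtain ⟨u, hu, hle⟩ := G.exists_eigenvalue_mul_degree_le hq h0
    have hd1 : (1 : ℝ) ≤ G.degree u := by exact_mod_cast hu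
    have hdpos : (0 : ℝ) < G.degree u := by linarith
    have hS : ∑ v ∈ G.neighborFinset u, (G.degree v : ℝ) + 9 ≤ 2 * G.degree u + 3 * n := by
      have := hG.1.isWeaklyPlanar.sum_degree_neighborFinset_le (by omega) hu
      rw [hcard] at this
      exact_mod_cast this
    have hΔ : ∑ v ∈ G.neighborFinset u, (G.degree v : ℝ) ≤ G.degree u * G.maxDegree := by
      exact_mod_cast G.sum_degree_neighborFinset_le_mul_maxDegree u
    have hmain : G.signlessLapRadius ≤ G.degree u + 2 + (3 * (n : ℝ) - 9) / G.degree u := by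
      rw [← sub_le_iff_le_add', le_div_iff₀ hdpos]
      nlinarith
    have hsmall : G.signlessLapRadius ≤ G.degree u + G.maxDegree := by
      refine le_of_mul_le_mul_right (hle.trans ?_) hdpos
      nlinarith
    have hbound : ∀ D : ℝ, 3 ≤ D → (n : ℝ) - 3 ≤ D → (G.maxDegree : ℝ) ≤ D →
        G.signlessLapRadius ≤ D + 2 + (3 * (n : ℝ) - 9) / D := by
      intro D hD3 hDn hDΔ
      rcases Nat.lt_or_ge (G.degree u) 3 with h | h
      · have h2 : (G.degree u : ℝ) ≤ 2 := by exact_mod_cast Nat.lt_succ_iff.mp h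
        have : 0 ≤ (3 * (n : ℝ) - 9) / D := div_nonneg (by linarith) (by linarith)
        linarith
      · have h3 : (3 : ℝ) ≤ G.degree u := by exact_mod_cast h
        have hdD : (G.degree u : ℝ) ≤ D :=
          (by exact_mod_cast G.degree_le_maxDegree u : (G.degree u : ℝ) ≤ G.maxDegree).trans hDΔ
        refine hmain.trans ?_
        have hDpos : 0 < D := by linarith
        -- The difference is nonnegative because d ≥ 3 and D ≥ n - 3 give dD ≥ 3n - 9.
        have key : (D + 2 + (3 * (n : ℝ) - 9) / D) -
            (G.degree u + 2 + (3 * (n : ℝ) - 9) / G.degree u) =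
            (D - G.degree u) * (G.degree u * D - (3 * n - 9)) / (G.degree u * D) := by
          field_simp
          ring
        have : 0 ≤ (D - G.degree u) * (G.degree u * D - (3 * n - 9)) / (G.degree u * D) := by
          refine div_nonneg (mul_nonneg (by linarith) ?_) (by positivity)
          nlinarith
        linarith
    refine ⟨hmain.trans (le_ciSup hbdd u), fun h => ?_, fun h => ?_, fun h => ?_⟩
    · have hD : (G.maxDegree : ℝ) = n - 1 := by
        rw [h, Nat.cast_sub (by omega)]; simp
      refine (hbound (n - 1) (by linarith) (by linarith) hD.le).trans_eq ?_
      have : (n : ℝ) - 1 ≠ 0 := by linarith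
      field_simp
      ring
    · have hD : (G.maxDegree : ℝ) = n - 2 := by
        rw [h, Nat.cast_sub (by omega)]; simp
      refine (hbound (n - 2) (by linarith) (by linarith) hD.le).trans_eq ?_
      have : (n : ℝ) - 2 ≠ 0 := by linarith
      field_simp
      ring
    · have hD : (G.maxDegree : ℝ) ≤ n - 3 := by
        have : G.maxDegree + 3 ≤ n := by omega
        have : (G.maxDegree : ℝ) + 3 ≤ n := by exact_mod_cast this
        linarith
      refine (hbound (n - 3) (by linarith) le_rfl hD).trans_eq ?_
      have : (n : ℝ) - 3 ≠ 0 := by linarith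
      field_simp
      ring
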